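/- Let $X$ be a linear metric space, i.e. a real topological vector space whose topology is metrizable, and let $\bar X\supseteq X$ be its completion (with respect to the canonical uniformity of the additive topological group $X$). For a dense linear subspace $L\subseteq X$, let $\sigma\dot{\mathcal Z}_{\{L\}}(X)$ denote the family of all subsets of $X$ that can be covered by countably many closed sets $F\subseteq X$ such that $L+\bar F$ has empty interior in $\bar X$, where $\bar F$ is the closure of $F$ in $\bar X$. Let $\sigma\dot{\mathcal Z}_\infty(X)=\bigcup_L\sigma\dot{\mathcal Z}_{\{L\}}(X)$, where $L$ ranges over all dense linear subspaces of $X$. A subset of $X$ is called analytic if it is a continuous image of a Polish space, and additive if it is closed under addition. Let $C\subseteq X$ be a convex set whose affine hull is dense in $X$ and which is densely-Polish, i.e. $C$ contains a Polish subspace that is dense in $C$. Then: 1. For any analytic sets $A,B\subseteq X$ with $A\notin\sigma\dot{\mathcal Z}_\infty(X)$ and $B\notin\sigma\dot{\mathcal Z}_\infty(X)$, the set $A+B+C$ has non-empty interior in $\bar X$. 2. For any analytic set $A\subseteq X$ with $A\notin\sigma\dot{\mathcal Z}_\infty(X)$ that is additive or convex, the set $A+C$ has non-empty interior in $\bar X$.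 -/

import Mathlib

open scoped Pointwise

namespace LinearMetric

/-- A closed subset `A` of an abelian topological group `G` is a dot-`Z` set with respect to a
family `𝒟` of subsets of `G` if for some `D ∈ 𝒟` the sum of `D` and the closure of `A` in the
completion of `G` has empty interior in the completion of `G`. -/
def IsDotZ {G : Type*} [AddCommGroup G] [UniformSpace G] [IsUniformAddGroup G]
    (𝒟 : Set (Set G)) (A : Set G) : Prop :=
  IsClosed A ∧ ∃ D ∈ 𝒟,
    interior (((↑) '' D : Set (UniformSpace.Completion G)) +
      closure ((↑) '' A : Set (UniformSpace.Completion G))) = ∅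

/-- The σ-ideal generated by the dot-`Z` sets with respect to `𝒟`: all subsets of `G` that are
covered by countably many such sets. -/
def sigmaDotZ {G : Type*} [AddCommGroup G] [UniformSpace G] [IsUniformAddGroup G]
    (𝒟 : Set (Set G)) : Set (Set G) :=
  {A | ∃ 𝓕 : Set (Set G), 𝓕.Countable ∧ (∀ F ∈ 𝓕, IsDotZ 𝒟 F) ∧ A ⊆ ⋃₀ 𝓕}

/-- The union, over all dense linear subspaces `L` of `X`, of the σ-ideals `sigmaDotZ {L}`. -/
def sigmaDotZInfty (X : Type*) [AddCommGroup X] [Module ℝ X] [UniformSpace X]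
    [IsUniformAddGroup X] : Set (Set X) :=
  ⋃ L ∈ {L : Submodule ℝ X | Dense (L : Set X)}, sigmaDotZ {(L : Set X)}

/-- `T`, with the subspace topology, contains a dense Polish subspace. -/
def DenselyPolish {X : Type*} [TopologicalSpace X] (T : Set X) : Prop :=
  ∃ P : Set X, P ⊆ T ∧ T ⊆ closure P ∧ PolishSpace P

/-- `A` is closed under addition (it need not contain zero). -/
def IsAdditive {G : Type*} [Add G] (A : Set G) : Prop := A + A ⊆ A

/-- The affine hull of `C` is dense in `X`. -/
def AffDense {X : Type*} [AddCommGroup X] [Module ℝ X] [TopologicalSpace X] (C : Set X) : Prop :=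
  Dense (affineSpan ℝ C : Set X)

/-- The set `S ⊆ X`, regarded as a subset of the completion of `X`, has non-empty interior in the
completion. -/
def HasInteriorInCompletion {X : Type*} [UniformSpace X] (S : Set X) : Prop :=
  (interior ((↑) '' S : Set (UniformSpace.Completion X))).Nonempty

end LinearMetric

open TopologicalSpace Set Topology

/-! Let `L` be the span of the differences of a sequence dense in a Polish `P` dense in `C`; it is
dense because the affine hull of `C` is. Since `A` is outside the σ-ideal of `L`, it is parametrized
by a closed `Z` in the Baire space all of whose non-empty open parts have images `T` with `L +
closure T` having interior in the completion. By convexity, countably many translates of any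
non-empty relatively open piece `S` of `C` cover `L`, so Baire category makes `S + T` somewhere
dense. Thus `(z, p) ↦ f z + p` on `Z × P` sends non-empty open sets to somewhere dense sets, and its
range is residual in some non-empty open set.

A Pettis-type argument for two such sums, each using half of `C`, gives part 1. Part 2 takes `B =
A`: `A + A` lies in `A` if `A` is additive, and is `2 • A` if `A` is convex. -/

/-- A continuous map from a Polish space that sends every non-empty open set to a somewhere dense
set has a range which is residual in some non-empty open set. -/
theorem exists_isOpen_inter_residual_subset_range {Y W : Type*} [TopologicalSpace Y]
    [PolishSpace Y] [Nonempty Y] [TopologicalSpace W] [FirstCountableTopology W] [T2Space W]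
    {h : Y → W} (hc : Continuous h)
    (hd : ∀ U : Set Y, IsOpen U → U.Nonempty → (interior (closure (h '' U))).Nonempty) :
    ∃ O R : Set W, IsOpen O ∧ O.Nonempty ∧ R ∈ residual W ∧ O ∩ R ⊆ range h := by
  let := upgradeIsCompletelyMetrizable Y
  set 𝓑 := countableBasis Y
  have h𝓑 : IsTopologicalBasis 𝓑 := isBasis_countableBasis Y
  let O : Set Y → Set W := fun B ↦ interior (closure (h '' B))
  let S : Set Y → ℕ → Set (Set Y) := fun B n ↦
    {B' | B' ∈ 𝓑 ∧ B' ⊆ B ∧ ∀ y ∈ B', ∀ z ∈ B', dist y z ≤ 1 / ((n : ℝ) + 1)}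
  let E : Set Y → ℕ → Set W := fun B n ↦ ⋃ B' ∈ S B n, O B'
  -- `G B n` is open and dense: a generic point of `O B` lies in `O B'` for some small `B' ⊆ B`.
  -- Iterating this yields shrinking basic sets whose limit point is a preimage.
  let G : Set Y → ℕ → Set W := fun B n ↦ E B n ∪ (closure (O B))ᶜ
  have hEo : ∀ B n, IsOpen (E B n) := fun B n ↦ isOpen_biUnion fun _ _ ↦ isOpen_interior
  have hGd : ∀ B ∈ 𝓑, ∀ n, Dense (G B n) := by
    intro B hB n
    rw [dense_iff_inter_open]
    intro V hV hVne
    by_cases hVO : (V ∩ O B).Nonempty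
    · obtain ⟨w, hwV, hwO⟩ := hVO
      obtain ⟨_, ⟨hvV, hvO⟩, y, hyB, rfl⟩ := mem_closure_iff.1 (interior_subset hwO) (V ∩ O B)
        (hV.inter isOpen_interior) ⟨hwV, hwO⟩
      have hopen : IsOpen (B ∩ h ⁻¹' V ∩ Metric.ball y (1 / (2 * ((n : ℝ) + 1)))) :=
        ((h𝓑.isOpen hB).inter (hV.preimage hc)).inter Metric.isOpen_ball
      obtain ⟨B', hB', hyB', hsub⟩ := h𝓑.exists_subset_of_mem_open
        (show y ∈ B ∩ h ⁻¹' V ∩ Metric.ball y (1 / (2 * ((n : ℝ) + 1))) from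
          ⟨⟨hyB, hvV⟩, Metric.mem_ball_self (by positivity)⟩) hopen
      obtain ⟨u, hu⟩ := hd B' (h𝓑.isOpen hB') ⟨y, hyB'⟩
      obtain ⟨_, hv, z, hz, rfl⟩ := mem_closure_iff.1 (interior_subset hu) (O B')
        isOpen_interior hu
      refine ⟨h z, (hsub hz).1.2, Or.inl (mem_biUnion (x := B') ⟨hB', ?_, ?_⟩ hv)⟩
      · exact fun a ha ↦ (hsub ha).1.1
      · intro a ha b hb
        have h1 := Metric.mem_ball.1 (hsub ha).2
        have h2 := Metric.mem_ball.1 (hsub hb).2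
        have h3 := dist_triangle_right a b y
        have h4 : 1 / (2 * ((n : ℝ) + 1)) + 1 / (2 * ((n : ℝ) + 1)) = 1 / ((n : ℝ) + 1) := by
          field_simp; norm_num
        linarith
    · obtain ⟨v, hv⟩ := hVne
      refine ⟨v, hv, Or.inr fun hvc ↦ hVO ?_⟩
      exact mem_closure_iff.1 hvc V hV hv
  obtain ⟨y₀⟩ := ‹Nonempty Y›
  obtain ⟨B₀, hB₀, hy₀, -⟩ := h𝓑.exists_subset_of_mem_open (mem_univ y₀) isOpen_univ
  refine ⟨O B₀, ⋂ B ∈ 𝓑, ⋂ n, G B n, isOpen_interior, hd B₀ (h𝓑.isOpen hB₀) ⟨y₀, hy₀⟩, ?_, ?_⟩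
  · refine (countable_bInter_mem (countable_countableBasis Y)).2 fun B hB ↦
      countable_iInter_mem.2 fun n ↦ ?_
    exact residual_of_dense_open ((hEo B n).union isClosed_closure.isOpen_compl) (hGd B hB n)
  · rintro x ⟨hxO, hxR⟩
    have step : ∀ (n : ℕ) (B : {B // B ∈ 𝓑 ∧ x ∈ O B}), ∃ B' : {B // B ∈ 𝓑 ∧ x ∈ O B},
        B'.1 ⊆ B.1 ∧ ∀ y ∈ B'.1, ∀ z ∈ B'.1, dist y z ≤ 1 / ((n : ℝ) + 1) := by
      rintro n ⟨B, hB, hxB⟩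
      have := mem_iInter.1 (mem_iInter₂.1 hxR B hB) n
      rcases this with hE | hE
      · obtain ⟨B', ⟨h1, h2, h3⟩, h4⟩ := mem_iUnion₂.1 hE
        exact ⟨⟨B', h1, h4⟩, h2, h3⟩
      · exact absurd (subset_closure hxB) hE
    choose next hnext using step
    let b : ℕ → {B // B ∈ 𝓑 ∧ x ∈ O B} := fun n ↦ Nat.rec ⟨B₀, hB₀, hxO⟩ next n
    have hb : ∀ n, b (n + 1) = next n (b n) := fun n ↦ rfl
    have hanti : Antitone fun n ↦ (b n).1 := antitone_nat_of_succ_le fun n ↦ (hnext n (b n)).1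
    obtain ⟨U, hU⟩ := (nhds x).exists_antitone_basis
    have hpick : ∀ n, ∃ y ∈ (b n).1, h y ∈ U n := by
      intro n
      obtain ⟨_, hv, y, hy, rfl⟩ := mem_closure_iff_nhds.1 (interior_subset (b n).2.2) (U n)
        (hU.1.mem_of_mem trivial)
      exact ⟨y, hy, hv⟩
    choose y hyb hyU using hpick
    have hcau : CauchySeq y := by
      -- `b 0` carries no diameter bound; `b (n + 1)` has diameter at most `1 / (n + 1)`.
      refine (cauchySeq_shift 1).1 ?_
      refine cauchySeq_of_le_tendsto_0 (fun n : ℕ ↦ 1 / ((n : ℝ) + 1)) ?_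
        tendsto_one_div_add_atTop_nhds_zero_nat
      intro n m N hn hm
      exact (hnext N (b N)).2 _ (hanti (by omega : N + 1 ≤ n + 1) (hyb (n + 1))) _
        (hanti (by omega : N + 1 ≤ m + 1) (hyb (m + 1)))
    obtain ⟨z, hz⟩ := cauchySeq_tendsto_of_complete hcau
    exact ⟨z, tendsto_nhds_unique ((hc.tendsto z).comp hz) (hU.tendsto hyU)⟩

/-- Sum of two sets that are residual in the open sets `O₁`, `O₂` contains `O₁ + O₂`. -/
theorem add_subset_add_of_inter_residual_subset {W : Type*} [AddCommGroup W] [TopologicalSpace W]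
    [IsTopologicalAddGroup W] [BaireSpace W] {O₁ R₁ S₁ O₂ R₂ S₂ : Set W}
    (hO₁ : IsOpen O₁) (hR₁ : R₁ ∈ residual W) (hS₁ : O₁ ∩ R₁ ⊆ S₁)
    (hO₂ : IsOpen O₂) (hR₂ : R₂ ∈ residual W) (hS₂ : O₂ ∩ R₂ ⊆ S₂) :
    O₁ + O₂ ⊆ S₁ + S₂ := by
  rintro _ ⟨a, ha, b, hb, rfl⟩
  -- The reflection `y ↦ a + b - y` preserves residual sets, so a generic `y` near `a` serves both
  -- summands.
  have hR : (Homeomorph.subLeft (a + b)) ⁻¹' R₂ ∈ residual W := by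
    rw [← (Homeomorph.subLeft (a + b)).residual_map_eq] at hR₂
    exact hR₂
  have hO : IsOpen (O₁ ∩ (Homeomorph.subLeft (a + b)) ⁻¹' O₂) :=
    hO₁.inter (hO₂.preimage (Homeomorph.continuous _))
  obtain ⟨y, ⟨hy₁, hy₂⟩, hy₃, hy₄⟩ := (dense_of_mem_residual
    (Filter.inter_mem hR₁ hR)).inter_open_nonempty _ hO
      ⟨a, ha, by simpa [Homeomorph.subLeft] using hb⟩
  exact ⟨y, hS₁ ⟨hy₁, hy₃⟩, a + b - y, hS₂ ⟨hy₂, hy₄⟩, by simp⟩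

theorem isCompletelyMetrizableSpace_completion (X : Type*) [UniformSpace X] [T0Space X]
    [(uniformity X).IsCountablyGenerated] :
    IsCompletelyMetrizableSpace (UniformSpace.Completion X) := by
  let := UniformSpace.metricSpace X
  infer_instance

/-- If countably many translates of `S` cover `L`, and `L + closure T` has an interior point, then
`S + T` is somewhere dense. -/
theorem nonempty_interior_closure_add_of_subset_iUnion_vadd {W : Type*} [AddCommGroup W]
    [TopologicalSpace W] [IsTopologicalAddGroup W] [BaireSpace W] {L S T M : Set W}
    (hM : M.Countable) (hL : L ⊆ M + S) (hT : (interior (L + closure T)).Nonempty) :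
    (interior (closure (S + T))).Nonempty := by
  by_contra hne
  refine not_isMeagre_of_isOpen isOpen_interior hT ?_
  have hsub : interior (L + closure T) ⊆ ⋃ m ∈ M, m +ᵥ closure (S + T) := by
    refine interior_subset.trans ?_
    rintro _ ⟨l, hl, t, ht, rfl⟩
    obtain ⟨m, hm, s, hs, rfl⟩ := hL hl
    refine mem_biUnion hm ⟨s + t, ?_, by simp [add_assoc]⟩
    exact map_mem_closure₂ continuous_add (subset_closure hs) ht fun a ha b hb ↦ ⟨a, ha, b, hb, rfl⟩
  refine IsMeagre.mono hsub (isMeagre_biUnion hM fun m _ ↦ IsNowhereDense.isMeagre ?_)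
  rw [(isClosed_closure.vadd m).isNowhereDense_iff, interior_vadd,
    not_nonempty_iff_eq_empty.1 hne, vadd_set_empty]

/-! ### Covering a span by translates of pieces of a convex set -/

section Convex

variable {X : Type*} [AddCommGroup X] [Module ℝ X] [TopologicalSpace X]
  [IsTopologicalAddGroup X] [ContinuousSMul ℝ X]

/-- Moving `c` slightly towards `u 0` stays in `V` and gives `u 0` a weight `s`, which can be
redistributed among the `u i`. The bound `ε = s / (J.card + 1)` keeps the redistributed total at
most `s`. -/
theorem exists_box_subset_of_convex {C V : Set X} (hC : Convex ℝ C) (hV : IsOpen V) {u : ℕ → X}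
    (hu : ∀ i, u i ∈ C) {c : X} (hc : c ∈ C) (hcV : c ∈ V) (J : Finset ℕ) :
    ∃ (x : X) (ε : ℝ), 0 < ε ∧ ∀ t : ℕ → ℝ, (∀ i, 0 ≤ t i ∧ t i ≤ ε) →
      x + ∑ i ∈ J, t i • (u i - u 0) ∈ C ∩ V := by
  let φ : ℝ × (J → ℝ) → X := fun p ↦
    (1 - p.1) • c + p.1 • u 0 + ∑ i : J, p.2 i • (u i - u 0)
  have hφ : Continuous φ := by fun_prop
  have hφ0 : φ 0 ∈ V := by simpa [φ] using hcV
  obtain ⟨δ, hδ, hball⟩ := Metric.isOpen_iff.1 (hV.preimage hφ) 0 hφ0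
  set s : ℝ := min (δ / 2) 1
  have hs0 : 0 < s := by positivity
  have hs1 : s ≤ 1 := min_le_right _ _
  have hsδ : s < δ := (min_le_left _ _).trans_lt (by linarith)
  have hn : (0 : ℝ) < J.card + 1 := by positivity
  refine ⟨(1 - s) • c + s • u 0, s / (J.card + 1), by positivity, fun t ht ↦ ?_⟩
  have hεs : s / (J.card + 1) ≤ s := div_le_self hs0.le (by simp)
  have hsum : ∑ i ∈ J, t i ≤ s := by
    calc ∑ i ∈ J, t i ≤ ∑ _i ∈ J, s / (J.card + 1) := Finset.sum_le_sum fun i _ ↦ (ht i).2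
      _ = J.card * (s / (J.card + 1)) := by simp
      _ ≤ (J.card + 1) * (s / (J.card + 1)) := by gcongr; linarith
      _ = s := by field_simp
  constructor
  · have key : (1 - s) • c + s • u 0 + ∑ i ∈ J, t i • (u i - u 0) =
        (1 - s) • c + ((s - ∑ i ∈ J, t i) • u 0 + ∑ i ∈ J, t i • u i) := by
      simp only [smul_sub, Finset.sum_sub_distrib, sub_smul, Finset.sum_smul]
      abel
    rw [key]
    let w : Option (Option ℕ) → ℝ := fun o ↦
      o.elim (1 - s) fun o ↦ o.elim (s - ∑ i ∈ J, t i) t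
    let z : Option (Option ℕ) → X := fun o ↦ o.elim c fun o ↦ o.elim (u 0) u
    have := hC.sum_mem (t := J.insertNone.insertNone) (w := w) (z := z) ?_ ?_ ?_
    · simpa [w, z, Finset.sum_insertNone] using this
    · rintro (_ | _ | i) _
      · simpa [w] using hs1
      · simpa [w] using hsum
      · exact (ht i).1
    · simp [w, Finset.sum_insertNone]
    · rintro (_ | _ | i) _
      exacts [hc, hu 0, hu i]
  · have hmem : ((s, fun i : J ↦ t i) : ℝ × (J → ℝ)) ∈ Metric.ball 0 δ := by
      rw [mem_ball_zero_iff, Prod.norm_def, max_lt_iff]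
      refine ⟨by simpa [abs_of_pos hs0] using hsδ, (pi_norm_lt_iff hδ).2 fun i ↦ ?_⟩
      rw [Real.norm_of_nonneg (ht i).1]
      exact ((ht i).2.trans hεs).trans_lt hsδ
    have := hball hmem
    simpa only [φ, mem_preimage, Finset.sum_coe_sort J fun i ↦ t i • (u i - u 0)] using this

/-- The linear span of countably many differences of points of a convex set `C` is covered by
countably many translates of any non-empty relatively open subset of `C`. -/
theorem exists_countable_span_subset_add_of_convex {C V : Set X} (hC : Convex ℝ C)
    (hV : IsOpen V) (hCV : (C ∩ V).Nonempty) {u : ℕ → X} (hu : ∀ i, u i ∈ C) :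
    ∃ M : Set X, M.Countable ∧
      (Submodule.span ℝ (range fun i ↦ u i - u 0) : Set X) ⊆ M + C ∩ V := by
  obtain ⟨c, hc, hcV⟩ := hCV
  choose x ε hε hbox using exists_box_subset_of_convex hC hV hu hc hcV
  -- Coefficients are reduced modulo `ε J`: the integer parts give countably many translations, the
  -- remainders fall in the box.
  refine ⟨range fun p : Finset ℕ × (ℕ →₀ ℤ) ↦
    ∑ i ∈ p.1, (ε p.1 * p.2 i) • (u i - u 0) - x p.1, countable_range _, ?_⟩
  intro l hl
  obtain ⟨a, rfl⟩ := Finsupp.mem_span_range_iff_exists_finsupp.1 hl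
  set J := a.support
  have hpos := hε J
  let m : ℕ →₀ ℤ := a.mapRange (fun r ↦ ⌊r / ε J⌋) (by simp)
  let t : ℕ → ℝ := fun i ↦ ε J * Int.fract (a i / ε J)
  refine ⟨_, ⟨(J, m), rfl⟩, _, hbox J t fun i ↦ ⟨?_, ?_⟩, ?_⟩
  · exact mul_nonneg hpos.le (Int.fract_nonneg _)
  · exact mul_le_of_le_one_right hpos.le (Int.fract_lt_one _).le
  · have : ∀ i, ε J * m i + t i = a i := by
      intro i
      simp only [m, t, Finsupp.mapRange_apply, ← mul_add, Int.floor_add_fract]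
      field_simp
    simp only [Finsupp.sum]
    rw [← add_assoc, sub_add_cancel, ← Finset.sum_add_distrib]
    exact Finset.sum_congr rfl fun i _ ↦ by rw [← add_smul, this]

theorem dense_span_range_sub {C : Set X} (hC : LinearMetric.AffDense C) {u : ℕ → X}
    (huC : C ⊆ closure (range u)) :
    Dense (Submodule.span ℝ (range fun i ↦ u i - u 0) : Set X) := by
  set L := Submodule.span ℝ (range fun i ↦ u i - u 0)
  have hCL : ∀ c ∈ C, c - u 0 ∈ L.topologicalClosure := by
    intro c hc
    refine map_mem_closure (f := fun x ↦ x - u 0) (by fun_prop) (huC hc) ?_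
    rintro _ ⟨i, rfl⟩
    exact Submodule.subset_span ⟨i, rfl⟩
  have hle : affineSpan ℝ C ≤ AffineSubspace.mk' (u 0) L.topologicalClosure := by
    rw [affineSpan_le]
    intro c hc
    simpa [AffineSubspace.mem_mk'] using hCL c hc
  have hd : Dense ((Homeomorph.subRight (u 0)) '' (affineSpan ℝ C : Set X)) :=
    (Homeomorph.subRight (u 0)).surjective.denseRange.dense_image
      (Homeomorph.subRight (u 0)).continuous hC
  have hd' : Dense (closure (L : Set X)) := by
    refine hd.mono ?_
    rintro _ ⟨c, hc, rfl⟩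
    exact (AffineSubspace.mem_mk' ..).1 (hle hc)
  exact dense_closure.1 hd'

end Convex

section SMul

variable {X : Type*} [AddCommGroup X] [Module ℝ X] [TopologicalSpace X] [ContinuousSMul ℝ X]

theorem LinearMetric.AffDense.smul {C : Set X} (hC : LinearMetric.AffDense C) {r : ℝ}
    (hr : r ≠ 0) : LinearMetric.AffDense (r • C) := by
  let e := Homeomorph.smulOfNeZero (α := X) r hr
  have hd : Dense (e '' (affineSpan ℝ C : Set X)) :=
    e.surjective.denseRange.dense_image e.continuous hC
  have := AffineSubspace.map_span (LinearMap.lsmul ℝ X r).toAffineMap C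
  have hcoe := congrArg (fun S : AffineSubspace ℝ X ↦ (S : Set X)) this
  simp only [AffineSubspace.coe_map] at hcoe
  change Dense (affineSpan ℝ (r • C) : Set X)
  rw [show r • C = (LinearMap.lsmul ℝ X r).toAffineMap '' C from rfl, ← hcoe]
  exact hd

theorem LinearMetric.DenselyPolish.smul {C : Set X} (hC : LinearMetric.DenselyPolish C) {r : ℝ}
    (hr : r ≠ 0) : LinearMetric.DenselyPolish (r • C) := by
  obtain ⟨P, hPC, hCP, hP⟩ := hC
  refine ⟨r • P, smul_set_mono hPC, ?_, ?_⟩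
  · rw [closure_smul₀' hr]
    exact smul_set_mono hCP
  · exact (((Homeomorph.smulOfNeZero (α := X) r hr).image P).symm.isClosedEmbedding).polishSpace

end SMul

/-! ### The σ-ideal and analytic sets outside it -/

section SigmaDotZ

variable {G : Type*} [AddCommGroup G] [UniformSpace G] [IsUniformAddGroup G] {𝒟 : Set (Set G)}

theorem sigmaDotZ_mono {A B : Set G} (hB : B ∈ LinearMetric.sigmaDotZ 𝒟) (h : A ⊆ B) :
    A ∈ LinearMetric.sigmaDotZ 𝒟 := by
  obtain ⟨F, h1, h2, h3⟩ := hB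
  exact ⟨F, h1, h2, h.trans h3⟩

theorem sigmaDotZ_biUnion {ι : Type*} {I : Set ι} (hI : I.Countable) {A : ι → Set G}
    (hA : ∀ i ∈ I, A i ∈ LinearMetric.sigmaDotZ 𝒟) :
    ⋃ i ∈ I, A i ∈ LinearMetric.sigmaDotZ 𝒟 := by
  choose! F h1 h2 h3 using hA
  refine ⟨⋃ i ∈ I, F i, hI.biUnion h1, ?_, ?_⟩
  · intro S hS
    obtain ⟨i, hi, hS⟩ := mem_iUnion₂.1 hS
    exact h2 i hi S hS
  · refine iUnion₂_subset fun i hi ↦ (h3 i hi).trans (sUnion_subset_sUnion ?_)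
    exact subset_biUnion_of_mem (u := F) hi

theorem sigmaDotZ_union {A B : Set G} (hA : A ∈ LinearMetric.sigmaDotZ 𝒟)
    (hB : B ∈ LinearMetric.sigmaDotZ 𝒟) : A ∪ B ∈ LinearMetric.sigmaDotZ 𝒟 := by
  obtain ⟨F, h1, h2, h3⟩ := hA
  obtain ⟨F', h1', h2', h3'⟩ := hB
  refine ⟨F ∪ F', h1.union h1', ?_, ?_⟩
  · rintro S (hS | hS)
    exacts [h2 S hS, h2' S hS]
  · rw [sUnion_union]
    exact union_subset_union h3 h3'

/-- An analytic set outside the σ-ideal is parametrized by a non-empty closed subset of the Baire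
space each of whose non-empty open parts has image outside the σ-ideal. -/
theorem exists_parametrization_of_notMem_sigmaDotZ {A : Set G} (hA : MeasureTheory.AnalyticSet A)
    (hA' : A ∉ LinearMetric.sigmaDotZ 𝒟) :
    ∃ (f : (ℕ → ℕ) → G) (Z : Set (ℕ → ℕ)), Continuous f ∧ IsClosed Z ∧ Z.Nonempty ∧
      range f ⊆ A ∧ ∀ V, IsOpen V → (V ∩ Z).Nonempty →
        f '' (V ∩ Z) ∉ LinearMetric.sigmaDotZ 𝒟 := by
  have hempty : (∅ : Set G) ∈ LinearMetric.sigmaDotZ 𝒟 :=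
    ⟨∅, countable_empty, by simp, empty_subset _⟩
  rw [MeasureTheory.AnalyticSet] at hA
  rcases hA with rfl | ⟨f, hf, rfl⟩
  · exact absurd hempty hA'
  -- Discard every basic open set with image in the ideal; countably many are removed, so what is
  -- left is hereditarily large.
  set I := {B ∈ countableBasis (ℕ → ℕ) | f '' B ∈ LinearMetric.sigmaDotZ 𝒟}
  have hU : f '' (⋃ B ∈ I, B) ∈ LinearMetric.sigmaDotZ 𝒟 := by
    rw [image_iUnion₂]
    exact sigmaDotZ_biUnion ((countable_countableBasis _).mono (sep_subset _ _)) fun B hB ↦ hB.2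
  refine ⟨f, (⋃ B ∈ I, B)ᶜ, hf, ?_, ?_, subset_rfl, ?_⟩
  · exact (isOpen_biUnion fun B hB ↦ isOpen_of_mem_countableBasis hB.1).isClosed_compl
  · rw [nonempty_compl]
    intro h
    exact hA' (by rwa [h, image_univ] at hU)
  · rintro V hV ⟨z, hzV, hzZ⟩ hmem
    obtain ⟨B, hB, hzB, hBV⟩ := (isBasis_countableBasis (ℕ → ℕ)).exists_subset_of_mem_open hzV hV
    refine hzZ (mem_biUnion (x := B) ⟨hB, ?_⟩ hzB)
    refine sigmaDotZ_mono (sigmaDotZ_union hmem hU) ?_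
    rintro _ ⟨b, hb, rfl⟩
    by_cases hbI : b ∈ ⋃ B ∈ I, B
    · exact Or.inr ⟨b, hbI, rfl⟩
    · exact Or.inl ⟨b, ⟨hBV hb, hbI⟩, rfl⟩

/-- Otherwise `closure T` alone would be a dot-`Z` cover of `T`. -/
theorem nonempty_interior_add_closure_of_notMem_sigmaDotZ {D T : Set G}
    (hT : T ∉ LinearMetric.sigmaDotZ {D}) :
    (interior (((↑) '' D : Set (UniformSpace.Completion G)) +
      closure ((↑) '' T : Set (UniformSpace.Completion G)))).Nonempty := by
  by_contra hne
  rw [not_nonempty_iff_eq_empty] at hne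
  refine hT ⟨{closure T}, countable_singleton _, ?_, by simpa using subset_closure⟩
  rintro _ rfl
  refine ⟨isClosed_closure, D, rfl, ?_⟩
  rwa [closure_image_closure (UniformSpace.Completion.continuous_coe G)]

end SigmaDotZ

theorem LinearMetric.HasInteriorInCompletion.of_smul {X : Type*} [AddCommGroup X]
    [Module ℝ X] [UniformSpace X] [IsUniformAddGroup X] [ContinuousSMul ℝ X] {S : Set X} {r : ℝ} (hr : r ≠ 0)
    (hS : LinearMetric.HasInteriorInCompletion (r • S)) :
    LinearMetric.HasInteriorInCompletion S := by
  have := uniformContinuousConstSMul_of_continuousConstSMul ℝ X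
  have himg : ((↑) '' (r • S) : Set (UniformSpace.Completion X)) = r • ((↑) '' S) := by
    simp only [← image_smul, image_image, UniformSpace.Completion.coe_smul]
  unfold LinearMetric.HasInteriorInCompletion at hS ⊢
  rw [himg, interior_smul₀ hr] at hS
  exact smul_set_nonempty.1 hS

section Main

variable {X : Type*} [AddCommGroup X] [Module ℝ X] [UniformSpace X]
    [IsUniformAddGroup X] [ContinuousSMul ℝ X] [MetrizableSpace X]

theorem exists_isOpen_inter_residual_subset_add {C : Set X} (hC : Convex ℝ C)
    (hCaff : LinearMetric.AffDense C) (hCpol : LinearMetric.DenselyPolish C) {A : Set X}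
    (hA : MeasureTheory.AnalyticSet A) (hA' : A ∉ LinearMetric.sigmaDotZInfty X) :
    ∃ O R : Set (UniformSpace.Completion X), IsOpen O ∧ O.Nonempty ∧
      R ∈ residual (UniformSpace.Completion X) ∧ O ∩ R ⊆ (↑) '' (A + C) := by
  have : (uniformity X).IsCountablyGenerated :=
    IsUniformAddGroup.uniformity_countably_generated
  have := isCompletelyMetrizableSpace_completion X
  let := upgradeIsCompletelyMetrizable (UniformSpace.Completion X)
  obtain ⟨P, hPC, hCP, hP⟩ := hCpol
  have hCne : C.Nonempty := by
    by_contra h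
    rw [not_nonempty_iff_eq_empty] at h
    obtain ⟨x, hx⟩ := hCaff.nonempty
    simp [h] at hx
  have hPne : P.Nonempty := closure_nonempty_iff.1 (hCne.mono hCP)
  have := hPne.to_subtype
  obtain ⟨v, hv⟩ := exists_dense_seq P
  have hu : ∀ i, (v i : X) ∈ C := fun i ↦ hPC (v i).2
  have huC : C ⊆ closure (range fun i ↦ (v i : X)) := by
    refine hCP.trans (closure_minimal ?_ isClosed_closure)
    intro p hp
    have := map_mem_closure continuous_subtype_val (hv ⟨p, hp⟩) (t := range fun i ↦ (v i : X))
      (by rintro _ ⟨i, rfl⟩; exact ⟨i, rfl⟩)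
    exact this
  set L := Submodule.span ℝ (range fun i ↦ (v i : X) - v 0)
  have hLd : Dense (L : Set X) := dense_span_range_sub hCaff huC
  have hAL : A ∉ LinearMetric.sigmaDotZ {(L : Set X)} := fun h ↦
    hA' (mem_biUnion (x := L) hLd h)
  obtain ⟨f, Z, hf, hZc, hZne, hfA, hfZ⟩ := exists_parametrization_of_notMem_sigmaDotZ hA hAL
  have := hZne.to_subtype
  have : PolishSpace Z := hZc.polishSpace
  let h : Z × P → UniformSpace.Completion X := fun q ↦ ((f q.1 + q.2 : X) : _)
  have hcont : Continuous h := (UniformSpace.Completion.continuous_coe X).comp (by fun_prop)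
  have hd : ∀ U : Set (Z × P), IsOpen U → U.Nonempty → (interior (closure (h '' U))).Nonempty := by
    rintro U hU ⟨⟨z, p⟩, hzp⟩
    obtain ⟨V', W', hV', hW', hz, hp, hsub⟩ := isOpen_prod_iff.1 hU z p hzp
    obtain ⟨V, hV, rfl⟩ := isOpen_induced_iff.1 hV'
    obtain ⟨W, hW, rfl⟩ := isOpen_induced_iff.1 hW'
    obtain ⟨M, hM, hLM⟩ := exists_countable_span_subset_add_of_convex hC hW ⟨p, hPC p.2, hp⟩ hu
    have hint := nonempty_interior_add_closure_of_notMem_sigmaDotZ (hfZ V hV ⟨z, hz, z.2⟩)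
    have hcover : ((↑) '' (L : Set X) : Set (UniformSpace.Completion X)) ⊆
        (↑) '' M + (↑) '' (C ∩ W) := by
      rintro _ ⟨l, hl, rfl⟩
      obtain ⟨m, hm, s, hs, rfl⟩ := hLM hl
      exact ⟨_, ⟨m, hm, rfl⟩, _, ⟨s, hs, rfl⟩, (UniformSpace.Completion.coe_add _ _).symm⟩
    refine (nonempty_interior_closure_add_of_subset_iUnion_vadd (hM.image _) hcover hint).mono
      (interior_mono (closure_minimal ?_ isClosed_closure))
    rintro _ ⟨_, ⟨s, ⟨hsC, hsW⟩, rfl⟩, _, ⟨t, ⟨y, ⟨hyV, hyZ⟩, rfl⟩, rfl⟩, rfl⟩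
    -- The covering of `L` needs all of `C ∩ W`, but `h` only sees `P`; density of `P` in `C` closes
    -- the gap.
    have hs : s ∈ closure (W ∩ P) := hW.inter_closure ⟨hsW, hCP hsC⟩
    have hg : Continuous fun s : X ↦ ((f y + s : X) : UniformSpace.Completion X) :=
      (UniformSpace.Completion.continuous_coe X).comp (by fun_prop)
    have := map_mem_closure hg hs (t := h '' U) ?_
    · simpa only [← UniformSpace.Completion.coe_add, add_comm s] using this
    · rintro q ⟨hqW, hqP⟩
      exact ⟨(⟨y, hyZ⟩, ⟨q, hqP⟩), hsub ⟨hyV, hqW⟩, rfl⟩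
  obtain ⟨O, R, hO, hOne, hR, hOR⟩ := exists_isOpen_inter_residual_subset_range hcont hd
  refine ⟨O, R, hO, hOne, hR, hOR.trans ?_⟩
  rintro _ ⟨⟨z, p⟩, rfl⟩
  exact ⟨_, ⟨f z, hfA ⟨z, rfl⟩, p, hPC p.2, rfl⟩, rfl⟩

/-- If `C` is convex, the sum of `A`, `B` and `C` decomposes as the sum of `A + C / 2` and
`B + C / 2`, both of which are residual in some open set. -/
theorem hasInteriorInCompletion_add_add {C : Set X} (hC : Convex ℝ C)
    (hCaff : LinearMetric.AffDense C) (hCpol : LinearMetric.DenselyPolish C) {A B : Set X}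
    (hA : MeasureTheory.AnalyticSet A) (hB : MeasureTheory.AnalyticSet B)
    (hA' : A ∉ LinearMetric.sigmaDotZInfty X) (hB' : B ∉ LinearMetric.sigmaDotZInfty X) :
    LinearMetric.HasInteriorInCompletion (A + B + C) := by
  have : (uniformity X).IsCountablyGenerated :=
    IsUniformAddGroup.uniformity_countably_generated
  have := isCompletelyMetrizableSpace_completion X
  let := upgradeIsCompletelyMetrizable (UniformSpace.Completion X)
  have h2 : (1 / 2 : ℝ) ≠ 0 := by norm_num
  obtain ⟨O₁, R₁, hO₁, hne₁, hR₁, hS₁⟩ := exists_isOpen_inter_residual_subset_add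
    (hC.smul (1 / 2)) (hCaff.smul h2) (hCpol.smul h2) hA hA'
  obtain ⟨O₂, R₂, hO₂, hne₂, hR₂, hS₂⟩ := exists_isOpen_inter_residual_subset_add
    (hC.smul (1 / 2)) (hCaff.smul h2) (hCpol.smul h2) hB hB'
  refine (hne₁.add hne₂).mono (interior_maximal ?_ hO₁.add_right)
  refine (add_subset_add_of_inter_residual_subset hO₁ hR₁ hS₁ hO₂ hR₂ hS₂).trans ?_
  rintro _ ⟨_, ⟨_, ⟨a, ha, _, ⟨c, hc, rfl⟩, rfl⟩, rfl⟩, _, ⟨_, ⟨b, hb, _, ⟨d, hd, rfl⟩, rfl⟩, rfl⟩,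
    rfl⟩
  refine ⟨a + b + ((1 / 2 : ℝ) • c + (1 / 2 : ℝ) • d), ⟨a + b, ⟨a, ha, b, hb, rfl⟩, _,
    hC hc hd (by norm_num) (by norm_num) (by norm_num), rfl⟩, ?_⟩
  simp only [← UniformSpace.Completion.coe_add]
  congr 1
  abel

end Main

theorem mainTheorem1 {X : Type*} [AddCommGroup X] [Module ℝ X] [UniformSpace X]
    [IsUniformAddGroup X] [ContinuousSMul ℝ X] [TopologicalSpace.MetrizableSpace X]
    (C : Set X) (hCconv : Convex ℝ C) (hCaff : LinearMetric.AffDense C)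
    (hCpol : LinearMetric.DenselyPolish C) :
    (∀ A B : Set X, MeasureTheory.AnalyticSet A → MeasureTheory.AnalyticSet B →
      A ∉ LinearMetric.sigmaDotZInfty X → B ∉ LinearMetric.sigmaDotZInfty X →
      LinearMetric.HasInteriorInCompletion (A + B + C)) ∧
    (∀ A : Set X, MeasureTheory.AnalyticSet A → A ∉ LinearMetric.sigmaDotZInfty X →
      (LinearMetric.IsAdditive A ∨ Convex ℝ A) →
      LinearMetric.HasInteriorInCompletion (A + C)) := by
  refine ⟨fun A B hA hB hA' hB' ↦ hasInteriorInCompletion_add_add hCconv hCaff hCpol hA hB hA' hB',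
    fun A hA hA' hAC ↦ ?_⟩
  rcases hAC with hadd | hconv
  · refine (hasInteriorInCompletion_add_add hCconv hCaff hCpol hA hA hA' hA').mono
      (interior_mono (image_mono (add_subset_add_right hadd)))
  -- Part 1 with `2 • C` applies to `A + A + 2 • C = 2 • (A + C)`.
  · have h2 : (2 : ℝ) ≠ 0 := by norm_num
    refine LinearMetric.HasInteriorInCompletion.of_smul h2 ?_
    have h := hasInteriorInCompletion_add_add (hCconv.smul 2) (hCaff.smul h2) (hCpol.smul h2)
      hA hA hA' hA'
    have hAA : A + A = (2 : ℝ) • A := by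
      have := hconv.add_smul (p := 1) (q := 1) zero_le_one zero_le_one
      rw [one_smul, one_add_one_eq_two] at this
      exact this.symm
    rwa [hAA, ← smul_add] at h
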